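/- Let $R$ and $S$ be commutative rings with identity, let $f\colon R\to S$ be a (unital) ring homomorphism, and let $J$ be a nonzero proper ideal of $S$. Let $$A := R\bowtie^f J=\{(r,f(r)+j)\mid r\in R,\ j\in J\}\subseteq R\times S$$ be the amalgamation, and assume that $A$ is finite. For a commutative ring $B$ let $Z(B)$ be its set of zero-divisors and $\mathrm{Nil}(B)$ its nilradical; let $E^\bullet=E\setminus\{0\}$. The zero-divisor graph $\Gamma(B)$ has vertex set $Z(B)^\bullet$, and distinct vertices $x,y$ are adjacent if and only if $xy=0$. Its diameter $\mathrm{diam}\,\Gamma(B)$ is the supremum of the distances between its vertices. Consider the properties - (a) $Z(R)^2=0$, i.e. $xy=0$ for all $x,y\in Z(R)$; - (b) $jf(r)\neq 0$ for every regular element (non-zero-divisor) $r$ of $R$ and every $j\in J^\bullet$; - (c) $jf(r)=0$ for every $r\in Z(R)^\bullet$ and every $j\in J^\bullet$; - (d) $J^2=0$. By a prime minimal with $J\not\subseteq\mathfrak q$ we mean a minimal element of the set of prime ideals $\mathfrak q$ of $S$ with $J\not\subseteq\mathfrak q$, ordered by inclusion. Then: 1. $\mathrm{diam}\,\Gamma(A)=0$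 if and only if $R$ is a field, $|J^\bullet|=1$ and $J^2=0$. Moreover, in this case (a), (b), (c) and (d) hold. 2. $\mathrm{diam}\,\Gamma(A)=1$ if and only if $A\cong\mathbb Z_2\times\mathbb Z_2$ as rings, or (a), (b), (c), (d) hold and $\mathrm{diam}\,\Gamma(A)>0$. 3. $\mathrm{diam}\,\Gamma(A)=2$ if and only if $\mathrm{diam}\,\Gamma(A)>1$ and either (i) $Z(R)$ is an ideal of $R$ and $J\subseteq\mathrm{Nil}(S)$, or (ii) $J\cap\mathrm{Nil}(S)=\{0\}$, $S$ has exactly one prime ideal $\mathfrak q$ minimal with $J\not\subseteq\mathfrak q$, and $R$ is a domain. 4. $\mathrm{diam}\,\Gamma(A)=3$ if and only if both of the following hold: (i) $Z(R)$ is not an ideal of $R$ or $J\not\subseteq\mathrm{Nil}(S)$; and (ii) $J\cap\mathrm{Nil}(S)\neq\{0\}$, or $S$ has more than one prime ideal $\mathfrak q$ minimal with $J\not\subseteq\mathfrak q$, or $R$ is not a domain. -/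

import Mathlib

/-- The set `Z(A)` of zero-divisors of a commutative ring `A`
(it contains `0` as soon as `A` is nontrivial). -/
def zeroDivisorSet (A : Type*) [CommRing A] : Set A :=
  {a | ∃ b : A, b ≠ 0 ∧ a * b = 0}

/-- The zero-divisor graph `Γ(A)`: the vertices are the nonzero zero-divisors of `A`, and two
distinct vertices are adjacent if and only if their product is zero. -/
def zeroDivisorGraph (A : Type*) [CommRing A] :
    SimpleGraph {a : A // a ∈ zeroDivisorSet A \ {0}} where
  Adj x y := x ≠ y ∧ (x : A) * (y : A) = 0
  symm := ⟨fun _ _ h => ⟨h.1.symm, by rw [mul_comm]; exact h.2⟩⟩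
  loopless := ⟨fun _ h => h.1 rfl⟩

/-- The amalgamation `R ⋈^f J = {(r, f r + j) | r ∈ R, j ∈ J}`, a subring of `R × S`. -/
def amalgamation {R S : Type*} [CommRing R] [CommRing S] (f : R →+* S) (J : Ideal S) :
    Subring (R × S) where
  carrier := {p | ∃ r : R, ∃ j ∈ J, p = (r, f r + j)}
  mul_mem' := by
    rintro _ _ ⟨r, i, hi, rfl⟩ ⟨s, j, hj, rfl⟩
    refine ⟨r * s, f r * j + f s * i + i * j,
      J.add_mem (J.add_mem (J.mul_mem_left _ hj) (J.mul_mem_left _ hi)) (J.mul_mem_left _ hj), ?_⟩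
    ext
    · rfl
    · simp only [Prod.mk_mul_mk, map_mul]
      ring
  one_mem' := ⟨1, 0, J.zero_mem, by ext <;> simp⟩
  add_mem' := by
    rintro _ _ ⟨r, i, hi, rfl⟩ ⟨s, j, hj, rfl⟩
    refine ⟨r + s, i + j, J.add_mem hi hj, ?_⟩
    ext
    · rfl
    · simp only [Prod.mk_add_mk, map_add]
      ring
  zero_mem' := ⟨0, 0, J.zero_mem, by ext <;> simp⟩
  neg_mem' := by
    rintro _ ⟨r, j, hj, rfl⟩
    refine ⟨-r, -j, J.neg_mem hj, ?_⟩
    ext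
    · rfl
    · simp only [Prod.neg_mk, map_neg]
      ring

/-- `Z(R)` is an ideal of `R`. -/
def ZeroDivisorsFormIdeal (R : Type*) [CommRing R] : Prop :=
  ∃ I : Ideal R, (I : Set R) = zeroDivisorSet R

/-- Property (a): `Z(R)² = 0`. -/
def PropA (R : Type*) [CommRing R] : Prop :=
  ∀ x ∈ zeroDivisorSet R, ∀ y ∈ zeroDivisorSet R, x * y = 0

/-- Property (b): `j f(r) ≠ 0` for every regular `r` of `R` and every nonzero `j` of `J`. -/
def PropB {R S : Type*} [CommRing R] [CommRing S] (f : R →+* S) (J : Ideal S) : Prop :=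
  ∀ r : R, r ∉ zeroDivisorSet R → ∀ j ∈ J, j ≠ 0 → j * f r ≠ 0

/-- Property (c): `j f(r) = 0` for every nonzero zero-divisor `r` of `R` and every nonzero
`j` of `J`. -/
def PropC {R S : Type*} [CommRing R] [CommRing S] (f : R →+* S) (J : Ideal S) : Prop :=
  ∀ r ∈ zeroDivisorSet R, r ≠ 0 → ∀ j ∈ J, j ≠ 0 → j * f r = 0

/-- Property (d): `J² = 0`. -/
def PropD {S : Type*} [CommRing S] (J : Ideal S) : Prop :=
  J ^ 2 = ⊥

/-- The conjunction of the properties (a), (b), (c) and (d). -/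
def PropABCD {R S : Type*} [CommRing R] [CommRing S] (f : R →+* S) (J : Ideal S) : Prop :=
  PropA R ∧ PropB f J ∧ PropC f J ∧ PropD J

/-- The prime ideals `q` of `S` that are minimal among the primes with `J ⊄ q`. -/
def minimalPrimesAvoiding {S : Type*} [CommRing S] (J : Ideal S) : Set (Ideal S) :=
  {q | Minimal (fun p : Ideal S => p.IsPrime ∧ ¬ J ≤ p) q}

/-!
All four statements follow from what the diameter of `Γ(B)` says about a finite ring `B`, applied
to `B = A = R ⋈^f J`.

For every commutative ring the diameter is at most `3`: if `xa = 0` and `yb = 0`, then either `ab`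
annihilates both `x` and `y`, or `x, a, b, y` is a path. The diameter is `1` only for `ℤ₂ × ℤ₂` or
when all products of zero-divisors vanish (`nonempty_ringEquiv_or_propA_of_ediam_eq_one`). For
finite `B` the diameter is at most `2` exactly when `B` is local, so that some nonzero element is
annihilated by the maximal ideal, or `B` is a product of two fields, so that `Γ(B)` is complete
bipartite (`ediam_le_two_iff`). Otherwise `B` has a nontrivial idempotent `e` with, say, `eB` not a
domain; for `ea, eb ≠ 0` with `eab = 0` the vertices `ea + (1 - e)` and `e` are at distance `3`.
Being a product of two fields is encoded as having two nonzero primes with zero intersection.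

It remains to translate these properties of `A` through the projections to `R` and `S`. In a finite
ring the zero-divisors are the nonunits.
* `A` is local iff `R` is local and `J` is nil, because the projection `A → R` has kernel `0 × J`
  (`isLocalRing_amalgamation_iff`).
* If `A` is a product of two fields, then `0 × J`, being a nonzero proper ideal, is one of the two
  primes, and any prime of `S` not containing `J` contracts to the other one. Such a prime is
  determined by its intersection with `J`, hence unique. Conversely, if `R` is a domain,
  `J ∩ Nil(S) = 0` and `q` is the only minimal prime avoiding `J`, then `0 × J` and the contraction
  of `q` are two nonzero primes with zero intersection (`ediam_amalgamation_le_two_iff`).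
* The zero-divisors of `A` have pairwise product zero iff the properties (a)–(d) hold.
-/

/-! ### Zero-divisors in finite rings -/

section FiniteRing

variable {B : Type*} [CommRing B]

theorem mem_zeroDivisorSet_iff_not_isUnit [Finite B] [Nontrivial B] {a : B} :
    a ∈ zeroDivisorSet B ↔ ¬ IsUnit a := by
  rw [isUnit_iff_mem_nonZeroDivisors_of_finite, mem_nonZeroDivisors_iff_right]
  simp only [zeroDivisorSet, Set.mem_ofPred_eq]
  push Not
  refine exists_congr fun b => ?_
  rw [mul_comm a b, and_comm]

theorem zeroDivisorsFormIdeal_iff_isLocalRing [Finite B] [Nontrivial B] :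
    ZeroDivisorsFormIdeal B ↔ IsLocalRing B := by
  constructor
  · rintro ⟨I, hI⟩
    refine IsLocalRing.of_nonunits_add fun a b ha hb => ?_
    have key : ∀ c : B, c ∈ nonunits B ↔ c ∈ I := fun c => by
      rw [← SetLike.mem_coe, hI, mem_zeroDivisorSet_iff_not_isUnit, mem_nonunits_iff]
    rw [key] at *
    exact I.add_mem ha hb
  · intro h
    refine ⟨IsLocalRing.maximalIdeal B, ?_⟩
    ext a
    rw [mem_zeroDivisorSet_iff_not_isUnit]
    simp

theorem exists_pow_isIdempotentElem {M : Type*} [Monoid M] [Finite M] (a : M) :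
    ∃ n, n ≠ 0 ∧ IsIdempotentElem (a ^ n) := by
  obtain ⟨i, j, hne, hij⟩ := Finite.exists_ne_map_eq_of_infinite fun n : ℕ => a ^ n
  wlog hlt : i < j generalizing i j
  · exact this j i hne.symm hij.symm (by omega)
  obtain ⟨p, hp, rfl⟩ : ∃ p, 0 < p ∧ j = i + p := ⟨j - i, by omega, by omega⟩
  have hper : ∀ k, i ≤ k → ∀ t, a ^ (k + t * p) = a ^ k := by
    intro k hk t
    induction t with
    | zero => simp
    | succ t ih =>
      obtain ⟨l, rfl⟩ := Nat.exists_eq_add_of_le hk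
      have : i + l + (t + 1) * p = (i + p) + (l + t * p) := by ring
      rw [this, pow_add, ← hij, ← pow_add, ← add_assoc, ih]
  have hle : i ≤ (i + 1) * p := by nlinarith
  exact ⟨(i + 1) * p, by positivity, by
    rw [IsIdempotentElem, ← pow_add]; exact hper _ hle _⟩

end FiniteRing

/-! ### The diameter of the zero-divisor graph -/

section Graph

variable {B : Type*} [CommRing B]

/-- The vertex of the zero-divisor graph given by `a ≠ 0`, with a witness `b ≠ 0` for `a` being a
zero-divisor. -/
def zeroDivisorVertex (a : B) (ha : a ≠ 0) (b : B) (hb : b ≠ 0) (hab : a * b = 0) :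
    {a : B // a ∈ zeroDivisorSet B \ {0}} :=
  ⟨a, ⟨b, hb, hab⟩, ha⟩

theorem edist_le_one_of_mul_eq_zero {u v : {a : B // a ∈ zeroDivisorSet B \ {0}}}
    (h : (u : B) * v = 0) : (zeroDivisorGraph B).edist u v ≤ 1 := by
  rw [SimpleGraph.edist_le_one_iff_adj_or_eq]
  by_cases huv : u = v
  · exact Or.inr huv
  · exact Or.inl ⟨huv, h⟩

theorem edist_le_two_of_common_annihilator {u v : {a : B // a ∈ zeroDivisorSet B \ {0}}}
    {w : B} (hw : w ≠ 0) (hu : (u : B) * w = 0) (hv : (v : B) * w = 0) :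
    (zeroDivisorGraph B).edist u v ≤ 2 := by
  let w' := zeroDivisorVertex w hw u u.2.2 (by rw [mul_comm, hu])
  calc _ ≤ _ := SimpleGraph.edist_triangle (v := w')
    _ ≤ 1 + 1 := add_le_add (edist_le_one_of_mul_eq_zero hu)
        (edist_le_one_of_mul_eq_zero (by rw [mul_comm]; exact hv))
    _ = 2 := one_add_one_eq_two

theorem ediam_zeroDivisorGraph_le_three : (zeroDivisorGraph B).ediam ≤ 3 := by
  refine SimpleGraph.ediam_le_of_edist_le fun u v => ?_
  obtain ⟨a, ha, hua⟩ := u.2.1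
  obtain ⟨b, hb, hvb⟩ := v.2.1
  by_cases hab : a * b = 0
  · let a' := zeroDivisorVertex a ha u u.2.2 (by rw [mul_comm, hua])
    calc _ ≤ _ := SimpleGraph.edist_triangle (v := a')
      _ ≤ 1 + 2 := add_le_add (edist_le_one_of_mul_eq_zero hua)
          (edist_le_two_of_common_annihilator hb hab hvb)
      _ = 3 := by norm_num
  · refine (edist_le_two_of_common_annihilator hab ?_ ?_).trans (by norm_num)
    · rw [← mul_assoc, hua, zero_mul]
    · rw [mul_left_comm, hvb, mul_zero]

/-- Two zero-divisors with nonzero product and no common nonzero annihilator have distance greater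
than `2`. They are distinct, since a zero-divisor has a nonzero annihilator. -/
theorem two_lt_ediam_of_forall_annihilator_eq_zero {x y b c : B} (hb : b ≠ 0) (hc : c ≠ 0)
    (hxb : x * b = 0) (hyc : y * c = 0) (hxy : x * y ≠ 0)
    (h : ∀ w, x * w = 0 → y * w = 0 → w = 0) : 2 < (zeroDivisorGraph B).ediam := by
  let u := zeroDivisorVertex x (left_ne_zero_of_mul hxy) b hb hxb
  let v := zeroDivisorVertex y (right_ne_zero_of_mul hxy) c hc hyc
  refine lt_of_lt_of_le (b := (zeroDivisorGraph B).edist u v) ?_ SimpleGraph.edist_le_ediam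
  rw [SimpleGraph.two_lt_edist_iff]
  refine ⟨?_, fun hadj => hxy hadj.2, ?_⟩
  · intro huv
    have : x = y := congrArg Subtype.val huv
    subst this
    exact hb (h b hxb hxb)
  · rw [Set.eq_empty_iff_forall_notMem]
    rintro w hw
    rw [SimpleGraph.mem_commonNeighbors] at hw
    exact w.2.2 (h w hw.1.2 hw.2.2)

theorem ediam_eq_one_iff_nontrivial_and_mul_eq_zero :
    (zeroDivisorGraph B).ediam = 1 ↔
      Nontrivial {a : B // a ∈ zeroDivisorSet B \ {0}} ∧
      ∀ u v : {a : B // a ∈ zeroDivisorSet B \ {0}}, u ≠ v → (u : B) * v = 0 := by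
  constructor
  · intro h
    have hn : Nontrivial {a : B // a ∈ zeroDivisorSet B \ {0}} :=
      SimpleGraph.nontrivial_of_ediam_ne_zero (G := zeroDivisorGraph B)
        (by rw [h]; exact one_ne_zero)
    refine ⟨hn, fun u v huv => ?_⟩
    rw [SimpleGraph.ediam_eq_one] at h
    have : (zeroDivisorGraph B).Adj u v := by rw [h]; exact huv
    exact this.2
  · rintro ⟨hn, h⟩
    rw [SimpleGraph.ediam_eq_one]
    ext u v
    exact ⟨fun huv => huv.1, fun huv => ⟨huv, h u v huv⟩⟩

open Classical in
/-- For a nonzero idempotent `e` with `eB = {0, e}`, the ring homomorphism `B → ZMod 2` obtained from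
the projection `a ↦ ae` onto the ring `eB`, which has two elements. -/
noncomputable def ringHomOfMulEq (e : B) (he : IsIdempotentElem e) (h0 : e ≠ 0)
    (h : ∀ a, a * e = 0 ∨ a * e = e) : B →+* ZMod 2 where
  toFun a := if a * e = 0 then 0 else 1
  map_zero' := by simp
  map_one' := by simp [h0]
  map_mul' a b := by
    have hab : a * b * e = (a * e) * (b * e) := by
      rw [mul_mul_mul_comm, he.eq]
    rw [hab]
    rcases h a with ha | ha <;> rcases h b with hb | hb <;> simp [ha, hb, h0, he.eq]
  map_add' a b := by
    have h2 : e + e = 0 := by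
      rcases h (1 + 1) with h2 | h2
      · rwa [add_mul, one_mul] at h2
      · rw [add_mul, one_mul, add_eq_left] at h2
        exact absurd h2 h0
    rw [add_mul]
    rcases h a with ha | ha <;> rcases h b with hb | hb <;> simp [ha, hb, h0, h2]
    decide

theorem ringHomOfMulEq_eq_zero_iff {e : B} {he : IsIdempotentElem e} {h0 : e ≠ 0}
    {h : ∀ a, a * e = 0 ∨ a * e = e} {a : B} :
    ringHomOfMulEq e he h0 h a = 0 ↔ a * e = 0 := by
  simp [ringHomOfMulEq]

theorem nonempty_ringEquiv_of_isIdempotentElem {e : B} (he : IsIdempotentElem e) (h0 : e ≠ 0)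
    (h1 : 1 - e ≠ 0) (h : ∀ a, a * e = 0 ∨ a * e = e)
    (h' : ∀ a, a * (1 - e) = 0 ∨ a * (1 - e) = 1 - e) :
    Nonempty (B ≃+* ZMod 2 × ZMod 2) := by
  let φ := ringHomOfMulEq e he h0 h
  let ψ := ringHomOfMulEq (1 - e) he.one_sub h1 h'
  have hφ : ∀ a, φ a = 0 ↔ a * e = 0 := fun a => ringHomOfMulEq_eq_zero_iff
  have hψ : ∀ a, ψ a = 0 ↔ a * (1 - e) = 0 := fun a => ringHomOfMulEq_eq_zero_iff
  refine ⟨RingEquiv.ofBijective (φ.prod ψ) ⟨?_, ?_⟩⟩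
  · rw [injective_iff_map_eq_zero]
    intro a ha
    rw [RingHom.prod_apply, Prod.mk_eq_zero, hφ, hψ] at ha
    linear_combination ha.1 + ha.2
  · have hψe : ψ e = 0 := by rw [hψ]; linear_combination -he.eq
    have hφe : φ e = 1 := by
      have : φ (1 - e) = 0 := by rw [hφ]; linear_combination -he.eq
      rw [map_sub, map_one, sub_eq_zero] at this
      exact this.symm
    rintro ⟨c, d⟩
    fin_cases c <;> fin_cases d
    · exact ⟨0, by simp; rfl⟩
    · exact ⟨1 - e, by simp [hφe, hψe]; rfl⟩
    · exact ⟨e, by simp [hφe, hψe]; rfl⟩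
    · exact ⟨1, by simp; rfl⟩

theorem ediam_eq_one_of_ringEquiv (h : Nonempty (B ≃+* ZMod 2 × ZMod 2)) :
    (zeroDivisorGraph B).ediam = 1 := by
  obtain ⟨g⟩ := h
  rw [ediam_eq_one_iff_nontrivial_and_mul_eq_zero]
  constructor
  · have hx : g.symm (1, 0) ≠ 0 := by rw [map_ne_zero_iff _ g.symm.injective]; decide
    have hy : g.symm (0, 1) ≠ 0 := by rw [map_ne_zero_iff _ g.symm.injective]; decide
    have hxy : g.symm (1, 0) * g.symm (0, 1) = 0 := by rw [← map_mul]; simp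
    refine ⟨zeroDivisorVertex _ hx _ hy hxy,
      zeroDivisorVertex _ hy _ hx (by rw [mul_comm, hxy]), fun huv => ?_⟩
    have := g.symm.injective (congrArg Subtype.val huv)
    simp at this
  · rintro ⟨x, ⟨b, hb, hxb⟩, hx⟩ ⟨y, ⟨c, hc, hyc⟩, hy⟩ hxy
    have key : ∀ x y : ZMod 2 × ZMod 2, x ≠ y → x ≠ 0 → y ≠ 0 → (∃ b, b ≠ 0 ∧ x * b = 0) →
      (∃ c, c ≠ 0 ∧ y * c = 0) → x * y = 0 := by decide
    rw [← map_eq_zero_iff g g.injective, map_mul]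
    refine key _ _ (fun h => hxy (Subtype.ext (g.injective h)))
      ((map_ne_zero_iff g g.injective).2 hx) ((map_ne_zero_iff g g.injective).2 hy)
      ⟨g b, (map_ne_zero_iff g g.injective).2 hb, by rw [← map_mul, hxb, map_zero]⟩
      ⟨g c, (map_ne_zero_iff g g.injective).2 hc, by rw [← map_mul, hyc, map_zero]⟩

/-- **Anderson–Livingston**: a zero-divisor graph of diameter one belongs to `ℤ₂ × ℤ₂` or to a
ring whose zero-divisors have pairwise product zero. -/
theorem nonempty_ringEquiv_or_propA_of_ediam_eq_one (h : (zeroDivisorGraph B).ediam = 1) :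
    Nonempty (B ≃+* ZMod 2 × ZMod 2) ∨ PropA B := by
  rw [ediam_eq_one_iff_nontrivial_and_mul_eq_zero] at h
  replace h : ∀ x ∈ zeroDivisorSet B, ∀ y ∈ zeroDivisorSet B, x ≠ y → x * y = 0 := by
    intro x hx y hy hxy
    by_cases hx0 : x = 0
    · rw [hx0, zero_mul]
    by_cases hy0 : y = 0
    · rw [hy0, mul_zero]
    exact h.2 ⟨x, hx, hx0⟩ ⟨y, hy, hy0⟩ fun h => hxy (congrArg Subtype.val h)
  have hmul : ∀ a, ∀ x ∈ zeroDivisorSet B, a * x ∈ zeroDivisorSet B := by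
    rintro a x ⟨b, hb, hxb⟩
    exact ⟨b, hb, by rw [mul_assoc, hxb, mul_zero]⟩
  by_cases hsq : ∀ x ∈ zeroDivisorSet B, x * x = 0
  · refine Or.inr fun x hx y hy => ?_
    by_cases hxy : x = y
    · rw [← hxy, hsq x hx]
    · exact h x hx y hy hxy
  left
  push Not at hsq
  obtain ⟨x, hx, hxx⟩ := hsq
  have hx0 : x ≠ 0 := left_ne_zero_of_mul hxx
  have hidem : ∀ a, a * x = x ∨ a * x * x = 0 := fun a => by
    by_cases hax : a * x = x
    · exact Or.inl hax
    · exact Or.inr (h _ (hmul a x hx) x hx hax)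
  have he : IsIdempotentElem x := by
    -- otherwise `x³ = 0`, and then `(1 + x)x` is a zero-divisor other than `x` with
    -- `(1 + x)x · x = x² ≠ 0`
    rcases hidem x with h1 | h1
    · exact h1
    · exfalso
      rcases hidem (1 + x) with h2 | h2
      · exact hxx (by linear_combination h2)
      · exact hxx (by linear_combination h2 - h1)
  have hz : ∀ z ∈ zeroDivisorSet B, IsIdempotentElem z → ∀ a, a * z = 0 ∨ a * z = z := by
    intro z hz hzz a
    by_cases haz : a * z = z
    · exact Or.inr haz
    · refine Or.inl ?_
      rw [← hzz.eq, ← mul_assoc]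
      exact h _ (hmul a z hz) z hz haz
  have h1 : 1 - x ≠ 0 := by
    intro h1
    obtain ⟨b, hb, hxb⟩ := hx
    exact hb (by linear_combination hxb + b * h1)
  exact nonempty_ringEquiv_of_isIdempotentElem he hx0 h1 (hz x hx he)
    (hz (1 - x) ⟨x, hx0, by linear_combination -he.eq⟩ he.one_sub)

theorem ediam_eq_one_of_propA (h : PropA B)
    (h0 : 0 < (zeroDivisorGraph B).ediam) : (zeroDivisorGraph B).ediam = 1 :=
  ediam_eq_one_iff_nontrivial_and_mul_eq_zero.2
    ⟨SimpleGraph.nontrivial_of_ediam_ne_zero h0.ne', fun u v _ => h u u.2.1 v v.2.1⟩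

/-- The ring has two nonzero primes with intersection zero; for a finite ring this says that it
is a product of two fields. -/
def HasTwoPrimeDecomposition (B : Type*) [CommRing B] : Prop :=
  ∃ P Q : Ideal B, P.IsPrime ∧ Q.IsPrime ∧ P ⊓ Q = ⊥ ∧ P ≠ ⊥ ∧ Q ≠ ⊥

theorem ediam_le_two_of_isLocalRing [Finite B] [IsLocalRing B] :
    (zeroDivisorGraph B).ediam ≤ 2 := by
  -- an associated prime is the maximal ideal, so the maximal ideal annihilates some `z ≠ 0`
  obtain ⟨P, hP, -⟩ := exists_le_isAssociatedPrime_of_isNoetherianRing B (1 : B) one_ne_zero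
  obtain ⟨hPp, z, hz⟩ := (isAssociatedPrime_iff).1 hP
  have hPm : P.IsMaximal := IsArtinianRing.isMaximal_of_isPrime P
  have hmem : ∀ a ∈ zeroDivisorSet B, a * z = 0 := by
    intro a ha
    have : a ∈ P := by
      rw [IsLocalRing.eq_maximalIdeal hPm, IsLocalRing.mem_maximalIdeal, mem_nonunits_iff]
      exact mem_zeroDivisorSet_iff_not_isUnit.1 ha
    rw [hz, Submodule.mem_colon_singleton] at this
    simpa using this
  have hz0 : z ≠ 0 := by
    rintro rfl
    apply hPp.ne_top
    rw [hz, Ideal.eq_top_iff_one, Submodule.mem_colon_singleton]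
    simp
  exact SimpleGraph.ediam_le_of_edist_le fun u v =>
    edist_le_two_of_common_annihilator hz0 (hmem u u.2.1) (hmem v v.2.1)

theorem ediam_le_two_of_hasTwoPrimeDecomposition (h : HasTwoPrimeDecomposition B) :
    (zeroDivisorGraph B).ediam ≤ 2 := by
  obtain ⟨P, Q, hP, hQ, hPQ, hP0, hQ0⟩ := h
  have hmul : ∀ a ∈ P, ∀ b ∈ Q, a * b = 0 := fun a ha b hb => by
    rw [← Ideal.mem_bot, ← hPQ]
    exact ⟨P.mul_mem_right b ha, Q.mul_mem_left a hb⟩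
  have hmem : ∀ a ∈ zeroDivisorSet B, a ∈ P ∨ a ∈ Q := by
    rintro a ⟨b, hb, hab⟩
    by_contra! hcon
    refine hb ?_
    rw [← Ideal.mem_bot, ← hPQ]
    exact ⟨(hP.mem_or_mem (hab ▸ P.zero_mem)).resolve_left hcon.1,
      (hQ.mem_or_mem (hab ▸ Q.zero_mem)).resolve_left hcon.2⟩
  obtain ⟨p, hp, hp0⟩ := Submodule.exists_mem_ne_zero_of_ne_bot hP0
  obtain ⟨q, hq, hq0⟩ := Submodule.exists_mem_ne_zero_of_ne_bot hQ0
  refine SimpleGraph.ediam_le_of_edist_le fun u v => ?_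
  rcases hmem u u.2.1 with hu | hu <;> rcases hmem v v.2.1 with hv | hv
  · exact edist_le_two_of_common_annihilator hq0 (hmul _ hu _ hq) (hmul _ hv _ hq)
  · exact (edist_le_one_of_mul_eq_zero (hmul _ hu _ hv)).trans (by norm_num)
  · exact (edist_le_one_of_mul_eq_zero (by rw [mul_comm]; exact hmul _ hv _ hu)).trans
      (by norm_num)
  · exact edist_le_two_of_common_annihilator hp0 (by rw [mul_comm]; exact hmul _ hp _ hu)
      (by rw [mul_comm]; exact hmul _ hp _ hv)

/-- If `Γ(B)` has diameter at most `2`, then the factor `eB` cut out by an idempotent `e ≠ 1` is a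
domain. -/
theorem eq_zero_or_eq_zero_of_ediam_le_two (h : (zeroDivisorGraph B).ediam ≤ 2) {e : B}
    (he : IsIdempotentElem e) (h1 : 1 - e ≠ 0) {a b : B}
    (hab : e * (a * b) = 0) : e * a = 0 ∨ e * b = 0 := by
  by_contra! hcon
  refine h.not_gt ?_
  -- `eB × (1 - e)B` contains the vertices `(a, 1)` and `(1, 0)`, which have no common annihilator
  refine two_lt_ediam_of_forall_annihilator_eq_zero (x := e * a + (1 - e)) (y := e)
    (b := e * b) (c := 1 - e) hcon.2 h1 ?_ ?_ ?_ ?_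
  · linear_combination e * hab - b * he.eq
  · linear_combination -he.eq
  · intro h
    exact hcon.1 (by linear_combination h + (1 - a) * he.eq)
  · intro w hw hew
    linear_combination hw + (1 - a) * hew

theorem isPrime_ker_mul_of_ediam_le_two (h : (zeroDivisorGraph B).ediam ≤ 2) {e : B}
    (he : IsIdempotentElem e) (h0 : e ≠ 0) (h1 : 1 - e ≠ 0) :
    Ideal.IsPrime (LinearMap.ker (LinearMap.mulLeft B e) : Ideal B) := by
  refine Ideal.isPrime_iff.2 ⟨?_, ?_⟩
  · rw [Ne, Ideal.eq_top_iff_one]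
    simpa using h0
  · intro a b hab
    exact eq_zero_or_eq_zero_of_ediam_le_two h he h1 hab

theorem ediam_le_two_iff [Finite B] [Nontrivial B] :
    (zeroDivisorGraph B).ediam ≤ 2 ↔ IsLocalRing B ∨ HasTwoPrimeDecomposition B := by
  constructor
  · intro h
    by_contra! hcon
    obtain ⟨hloc, htwo⟩ := hcon
    obtain ⟨a, ha, ha'⟩ : ∃ a : B, ¬ IsUnit a ∧ ¬ IsUnit (1 - a) := by
      by_contra! hall
      exact hloc (IsLocalRing.of_isUnit_or_isUnit_one_sub_self fun a =>
        or_iff_not_imp_left.2 (hall a))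
    obtain ⟨n, hn, he⟩ := exists_pow_isIdempotentElem a
    have h0 : a ^ n ≠ 0 := fun h0 => ha' (IsNilpotent.isUnit_one_sub ⟨n, h0⟩)
    have h1 : 1 - a ^ n ≠ 0 := fun h1 =>
      ha ((isUnit_pow_iff hn).1 (by rw [← sub_eq_zero.1 h1]; exact isUnit_one))
    set e := a ^ n
    -- the primes are the annihilators of `e` and of `1 - e`
    refine htwo ⟨_, _, isPrime_ker_mul_of_ediam_le_two h he h0 h1,
      isPrime_ker_mul_of_ediam_le_two h he.one_sub h1 (by simpa using h0), ?_, ?_, ?_⟩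
    · rw [eq_bot_iff]
      rintro x ⟨hx1, hx2⟩
      have hx1' : e * x = 0 := hx1
      have hx2' : (1 - e) * x = 0 := hx2
      rw [Ideal.mem_bot]
      linear_combination hx1' + hx2'
    · refine Submodule.ne_bot_iff _ |>.2 ⟨1 - e, ?_, h1⟩
      change e * (1 - e) = 0
      linear_combination -he.eq
    · refine Submodule.ne_bot_iff _ |>.2 ⟨e, ?_, h0⟩
      change (1 - e) * e = 0
      linear_combination -he.eq
  · rintro (h | h)
    · exact ediam_le_two_of_isLocalRing
    · exact ediam_le_two_of_hasTwoPrimeDecomposition h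

end Graph

/-! ### The amalgamation and its projections -/

section Amalgamation

variable {R S : Type*} [CommRing R] [CommRing S] (f : R →+* S) (J : Ideal S)

/-- The projection of the amalgamation onto `R`. -/
def amalgamationFst : amalgamation f J →+* R :=
  (RingHom.fst R S).comp (amalgamation f J).subtype

/-- The projection of the amalgamation to `S`. -/
def amalgamationSnd : amalgamation f J →+* S :=
  (RingHom.snd R S).comp (amalgamation f J).subtype

/-- The section `r ↦ (r, f r)` of the projection of the amalgamation onto `R`. -/
def amalgamationDiag (r : R) : amalgamation f J :=
  ⟨(r, f r), r, 0, J.zero_mem, by simp⟩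

variable {J} in
/-- The element `(0, j)` of the amalgamation, for `j ∈ J`. -/
def amalgamationInr {j : S} (hj : j ∈ J) : amalgamation f J :=
  ⟨(0, j), 0, j, hj, by simp⟩

variable {f J}

@[simp] theorem amalgamationFst_diag (r : R) :
    amalgamationFst f J (amalgamationDiag f J r) = r := rfl

@[simp] theorem amalgamationSnd_diag (r : R) :
    amalgamationSnd f J (amalgamationDiag f J r) = f r := rfl

@[simp] theorem amalgamationFst_inr {j : S} (hj : j ∈ J) :
    amalgamationFst f J (amalgamationInr f hj) = 0 := rfl

@[simp] theorem amalgamationSnd_inr {j : S} (hj : j ∈ J) :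
    amalgamationSnd f J (amalgamationInr f hj) = j := rfl

theorem amalgamation_ext {a b : amalgamation f J}
    (h1 : amalgamationFst f J a = amalgamationFst f J b)
    (h2 : amalgamationSnd f J a = amalgamationSnd f J b) : a = b :=
  Subtype.ext (Prod.ext h1 h2)

theorem amalgamationSnd_sub_mem (a : amalgamation f J) :
    amalgamationSnd f J a - f (amalgamationFst f J a) ∈ J := by
  obtain ⟨_, r, j, hj, rfl⟩ := a
  simpa [amalgamationSnd, amalgamationFst] using hj

theorem exists_eq_amalgamationInr {a : amalgamation f J} (h : amalgamationFst f J a = 0) :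
    ∃ (j : S) (hj : j ∈ J), a = amalgamationInr f hj := by
  have := amalgamationSnd_sub_mem a
  rw [h, map_zero, sub_zero] at this
  exact ⟨_, this, amalgamation_ext h rfl⟩

theorem amalgamationInr_eq_zero_iff {j : S} {hj : j ∈ J} :
    amalgamationInr f hj = 0 ↔ j = 0 :=
  ⟨fun h => congrArg (amalgamationSnd f J) h, fun h => amalgamation_ext rfl h⟩

theorem amalgamationDiag_eq_zero_iff {r : R} : amalgamationDiag f J r = 0 ↔ r = 0 :=
  ⟨fun h => congrArg (amalgamationFst f J) h,
    fun h => amalgamation_ext h (by simp [h])⟩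

theorem amalgamationFst_surjective : Function.Surjective (amalgamationFst f J) :=
  fun r => ⟨amalgamationDiag f J r, rfl⟩

/-- If `J` is nil, then the kernel `0 × J` of the projection to `R` is nil, so units lift. -/
theorem isUnit_of_isUnit_amalgamationFst (hJ : J ≤ nilradical S) {a : amalgamation f J}
    (h : IsUnit (amalgamationFst f J a)) : IsUnit a := by
  obtain ⟨r, hr⟩ := h.exists_right_inv
  obtain ⟨j, hj, hab⟩ := exists_eq_amalgamationInr
    (a := a * amalgamationDiag f J r - 1) (by simp [hr])
  have hnil : IsNilpotent (a * amalgamationDiag f J r - 1) := by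
    obtain ⟨n, hn⟩ := mem_nilradical.1 (hJ hj)
    refine ⟨n + 1, amalgamation_ext ?_ ?_⟩
    · simp [hab]
    · simp [hab, pow_succ, hn]
  have := hnil.isUnit_add_one
  rw [sub_add_cancel] at this
  exact isUnit_of_mul_isUnit_left this

theorem isLocalRing_amalgamation_iff [Finite (amalgamation f J)] [Nontrivial R] :
    IsLocalRing (amalgamation f J) ↔ IsLocalRing R ∧ J ≤ nilradical S := by
  constructor
  · intro h
    refine ⟨IsLocalRing.of_surjective' (amalgamationFst f J) amalgamationFst_surjective, ?_⟩
    intro j hj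
    -- an idempotent power of the nonunit `(0, j)` of a local ring is zero
    obtain ⟨n, hn, he⟩ := exists_pow_isIdempotentElem (amalgamationInr f hj)
    have hunit : IsUnit (1 - amalgamationInr f hj ^ n) := by
      refine (IsLocalRing.isUnit_or_isUnit_one_sub_self (amalgamationInr f hj ^ n)).resolve_left
        fun hu => ?_
      have := hu.map (amalgamationFst f J)
      simp [hn] at this
    have h0 : amalgamationInr f hj ^ n = 0 := by
      rw [← hunit.mul_right_eq_zero]
      linear_combination -he.eq
    refine mem_nilradical.2 ⟨n, ?_⟩
    simpa using congrArg (amalgamationSnd f J) h0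
  · rintro ⟨hR, hJ⟩
    have : IsLocalHom (amalgamationFst f J) := ⟨fun a ha => isUnit_of_isUnit_amalgamationFst hJ ha⟩
    exact RingHom.domain_isLocalRing (amalgamationFst f J)

/-! ### Minimal primes avoiding `J` -/

/-- A prime below one that avoids `J` avoids `J` as well, so minimality among the primes avoiding `J`
is minimality among all primes. -/
theorem mem_minimalPrimesAvoiding_iff {q : Ideal S} :
    q ∈ minimalPrimesAvoiding J ↔ q ∈ minimalPrimes S ∧ ¬ J ≤ q := by
  rw [minimalPrimes_eq_minimals]
  change Minimal (fun p : Ideal S => p.IsPrime ∧ ¬ J ≤ p) q ↔ Minimal Ideal.IsPrime q ∧ ¬ J ≤ q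
  constructor
  · intro h
    exact ⟨⟨h.prop.1, fun p hp hpq => h.le_of_le ⟨hp, fun hJp => h.prop.2 (hJp.trans hpq)⟩ hpq⟩,
      h.prop.2⟩
  · rintro ⟨h, hJq⟩
    exact ⟨⟨h.prop, hJq⟩, fun p hp hpq => h.le_of_le hp.1 hpq⟩

theorem isPrime_of_mem_minimalPrimesAvoiding {q : Ideal S} (hq : q ∈ minimalPrimesAvoiding J) :
    q.IsPrime :=
  Ideal.IsMinimalPrime.isPrime (mem_minimalPrimesAvoiding_iff.1 hq).1

theorem not_le_of_mem_minimalPrimesAvoiding {q : Ideal S} (hq : q ∈ minimalPrimesAvoiding J) :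
    ¬ J ≤ q :=
  (mem_minimalPrimesAvoiding_iff.1 hq).2

theorem exists_mem_minimalPrimesAvoiding_le {p : Ideal S} (hp : p.IsPrime) (hJp : ¬ J ≤ p) :
    ∃ q ∈ minimalPrimesAvoiding J, q ≤ p := by
  obtain ⟨q, hq, hqp⟩ := Ideal.exists_minimalPrimes_le (I := ⊥) (J := p) bot_le
  exact ⟨q, mem_minimalPrimesAvoiding_iff.2 ⟨hq, fun h => hJp (h.trans hqp)⟩, hqp⟩

theorem minimalPrimesAvoiding_nonempty (hJ : ¬ J ≤ nilradical S) :
    (minimalPrimesAvoiding J).Nonempty := by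
  rw [nilradical_eq_sInf, le_sInf_iff] at hJ
  push Not at hJ
  obtain ⟨p, hp, hJp⟩ := hJ
  obtain ⟨q, hq, -⟩ := exists_mem_minimalPrimesAvoiding_le hp hJp
  exact ⟨q, hq⟩

/-- A prime not containing `J` is determined by its intersection with `J`. -/
theorem eq_of_forall_mem_iff_of_not_le {p q : Ideal S} (hp : p.IsPrime) (hq : q.IsPrime)
    (hJp : ¬ J ≤ p) (hJq : ¬ J ≤ q) (h : ∀ j ∈ J, j ∈ p ↔ j ∈ q) : p = q := by
  have key : ∀ {p q : Ideal S}, q.IsPrime → ¬ J ≤ q → (∀ j ∈ J, j ∈ p ↔ j ∈ q) → p ≤ q := by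
    intro p q hq hJq h x hx
    obtain ⟨j, hj, hjq⟩ := SetLike.not_le_iff_exists.1 hJq
    exact (hq.mem_or_mem ((h _ (J.mul_mem_left x hj)).1 (p.mul_mem_right j hx))).resolve_right hjq
  exact le_antisymm (key hq hJq h) (key hp hJp fun j hj => (h j hj).symm)

/-! ### Amalgamations that are products of two fields -/

theorem isDomain_of_hasTwoPrimeDecomposition [Finite (amalgamation f J)] [Nontrivial R]
    (hJ0 : J ≠ ⊥) (h : HasTwoPrimeDecomposition (amalgamation f J)) :
    IsDomain R ∧ J ⊓ nilradical S = ⊥ ∧ (minimalPrimesAvoiding J).Subsingleton := by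
  obtain ⟨P, Q, hP, hQ, hPQ, -, -⟩ := h
  set N := RingHom.ker (amalgamationFst f J) with hN
  have hN0 : N ≠ ⊥ := by
    obtain ⟨j, hj, hj0⟩ := Submodule.exists_mem_ne_zero_of_ne_bot hJ0
    exact (Submodule.ne_bot_iff _).2 ⟨amalgamationInr f hj, amalgamationFst_inr hj,
      mt amalgamationInr_eq_zero_iff.1 hj0⟩
  have hNtop : N ≠ ⊤ := RingHom.ker_ne_top _
  have hmax : ∀ I : Ideal (amalgamation f J), I.IsPrime → I.IsMaximal := fun I _ =>
    IsArtinianRing.isMaximal_of_isPrime I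
  -- the kernel of the projection to `R` avoids one of the two primes, say `Q`
  wlog hNQ : ¬ N ≤ Q generalizing P Q
  · refine this Q P hQ hP (by rw [inf_comm, hPQ]) fun hNP => hN0 ?_
    rw [eq_bot_iff, ← hPQ]
    exact le_inf hNP (not_not.1 hNQ)
  have hmul : P * Q = ⊥ := by
    rw [eq_bot_iff, ← hPQ]; exact Ideal.mul_le_inf
  have hNQtop : N ⊔ Q = ⊤ := by
    exact ((hmax Q hQ).1.2 _ (lt_of_le_of_ne le_sup_right fun h => hNQ (h ▸ le_sup_left)))
  have hPN : P ≤ N := by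
    calc P = P * (N ⊔ Q) := by rw [hNQtop, Ideal.mul_top]
      _ = P * N := by rw [Ideal.mul_sup, hmul, sup_bot_eq]
      _ ≤ N := Ideal.mul_le_right
  have hNP : P = N := (hmax P hP).eq_of_le hNtop hPN
  refine ⟨?_, ?_, ?_⟩
  · rw [hNP] at hP
    exact (RingHom.quotientKerEquivOfSurjective
      (amalgamationFst_surjective (f := f) (J := J))).symm.toMulEquiv.isDomain _
  · rw [eq_bot_iff]
    rintro j ⟨hj, hnil⟩
    obtain ⟨n, hn⟩ := mem_nilradical.1 hnil
    have h0 : amalgamationInr f hj ^ (n + 1) = 0 :=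
      amalgamation_ext (by simp) (by simp [pow_succ, hn])
    have : amalgamationInr f hj ∈ P ⊓ Q :=
      ⟨hP.mem_of_pow_mem _ (h0 ▸ P.zero_mem), hQ.mem_of_pow_mem _ (h0 ▸ Q.zero_mem)⟩
    rw [hPQ, Ideal.mem_bot, amalgamationInr_eq_zero_iff] at this
    exact this
  · -- a prime `q` avoiding `J` pulls back to `Q`, hence is determined on `J`
    have key : ∀ q ∈ minimalPrimesAvoiding J, q.comap (amalgamationSnd f J) = Q := by
      intro q hq
      have hqp : q.IsPrime := isPrime_of_mem_minimalPrimesAvoiding hq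
      have hq' := Ideal.comap_isPrime (amalgamationSnd f J) q
      have hle : P * Q ≤ q.comap (amalgamationSnd f J) := by rw [hmul]; exact bot_le
      rcases hq'.mul_le.1 hle with h | h
      · exfalso
        refine not_le_of_mem_minimalPrimesAvoiding hq fun j hj => ?_
        have : amalgamationInr f hj ∈ q.comap (amalgamationSnd f J) :=
          h (hPN.antisymm hNP.ge ▸ (amalgamationFst_inr hj : amalgamationInr f hj ∈ N))
        exact this
      · exact ((hmax Q hQ).eq_of_le hq'.ne_top h).symm
    intro p hp q hq
    refine eq_of_forall_mem_iff_of_not_le (isPrime_of_mem_minimalPrimesAvoiding hp)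
      (isPrime_of_mem_minimalPrimesAvoiding hq) (not_le_of_mem_minimalPrimesAvoiding hp)
      (not_le_of_mem_minimalPrimesAvoiding hq) fun j hj => ?_
    have := (key p hp).trans (key q hq).symm
    exact (SetLike.ext_iff.1 this) (amalgamationInr f hj)

theorem hasTwoPrimeDecomposition_of_isDomain [Finite (amalgamation f J)] [IsDomain R]
    (hJ0 : J ≠ ⊥) (hnil : J ⊓ nilradical S = ⊥) {q : Ideal S} (hq : q ∈ minimalPrimesAvoiding J)
    (huniq : ∀ p ∈ minimalPrimesAvoiding J, p = q) :
    HasTwoPrimeDecomposition (amalgamation f J) := by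
  have hqp : q.IsPrime := isPrime_of_mem_minimalPrimesAvoiding hq
  have hNp := RingHom.ker_isPrime (amalgamationFst f J)
  have hQp := Ideal.comap_isPrime (amalgamationSnd f J) q
  have hN0 : RingHom.ker (amalgamationFst f J) ≠ ⊥ := by
    obtain ⟨j, hj, hj0⟩ := Submodule.exists_mem_ne_zero_of_ne_bot hJ0
    exact (Submodule.ne_bot_iff _).2 ⟨amalgamationInr f hj, amalgamationFst_inr hj,
      mt amalgamationInr_eq_zero_iff.1 hj0⟩
  refine ⟨_, _, hNp, hQp, ?_, hN0, fun hQ0 => ?_⟩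
  · -- `J ⊓ q` lies in every prime: those avoiding `J` contain `q`, the others contain `J`
    rw [eq_bot_iff]
    rintro a ⟨ha, haq⟩
    obtain ⟨j, hj, rfl⟩ := exists_eq_amalgamationInr ha
    have hjq : j ∈ q := haq
    have hjnil : j ∈ nilradical S := by
      rw [nilradical_eq_sInf, Ideal.mem_sInf]
      intro p hp
      by_cases hJp : J ≤ p
      · exact hJp hj
      · obtain ⟨p', hp', hle⟩ := exists_mem_minimalPrimesAvoiding_le hp hJp
        rw [huniq p' hp'] at hle
        exact hle hjq
    have : j ∈ J ⊓ nilradical S := ⟨hj, hjnil⟩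
    rw [hnil, Ideal.mem_bot] at this
    exact amalgamationInr_eq_zero_iff.2 this
  · -- a finite domain is a field, but the kernel of the projection to `R` is neither `⊥` nor `⊤`
    have hmax : (Ideal.comap (amalgamationSnd f J) q).IsMaximal :=
      IsArtinianRing.isMaximal_of_isPrime _
    have := hmax.eq_of_le hNp.ne_top (hQ0.le.trans bot_le)
    exact hN0 (this.symm.trans hQ0)

/-! ### The diameter of the zero-divisor graph of an amalgamation -/

theorem propABCD_of_propA_amalgamation [Finite (amalgamation f J)] [Finite R] [Nontrivial R]
    (h : PropA (amalgamation f J)) : PropABCD f J := by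
  have : Nontrivial (amalgamation f J) := (amalgamationFst f J).domain_nontrivial
  have hmem : ∀ a : amalgamation f J, ¬ IsUnit (amalgamationFst f J a) →
      a ∈ zeroDivisorSet (amalgamation f J) := fun a ha =>
    mem_zeroDivisorSet_iff_not_isUnit.2 fun hu => ha (hu.map _)
  have hinr : ∀ {j : S} (hj : j ∈ J), amalgamationInr f hj ∈ zeroDivisorSet (amalgamation f J) :=
    fun hj => hmem _ (by simp)
  have hdiag : ∀ r ∈ zeroDivisorSet R,
      amalgamationDiag f J r ∈ zeroDivisorSet (amalgamation f J) :=
    fun r hr => hmem _ (mem_zeroDivisorSet_iff_not_isUnit.1 hr)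
  refine ⟨fun x hx y hy => ?_, fun r hr j hj hj0 hjr => ?_, fun r hr _ j hj _ => ?_, ?_⟩
  · exact congrArg (amalgamationFst f J) (h _ (hdiag x hx) _ (hdiag y hy))
  · have hu : IsUnit r := not_not.1 (mt mem_zeroDivisorSet_iff_not_isUnit.2 hr)
    exact hj0 ((hu.map f).mul_left_eq_zero.1 hjr)
  · exact congrArg (amalgamationSnd f J) (h _ (hinr hj) _ (hdiag r hr))
  · rw [PropD, eq_bot_iff, sq, Ideal.mul_le]
    intro i hi j hj
    exact congrArg (amalgamationSnd f J) (h _ (hinr hi) _ (hinr hj))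

theorem propA_amalgamation_of_propABCD [Finite (amalgamation f J)] [Finite R] [Nontrivial R]
    (h : PropABCD f J) : PropA (amalgamation f J) := by
  have : Nontrivial (amalgamation f J) := (amalgamationFst f J).domain_nontrivial
  obtain ⟨hA, -, hC, hD⟩ := h
  have hJJ : ∀ i ∈ J, ∀ j ∈ J, i * j = 0 := fun i hi j hj => by
    rw [← Ideal.mem_bot, ← hD, sq]
    exact Ideal.mul_mem_mul hi hj
  have hJ : J ≤ nilradical S := fun j hj => mem_nilradical.2 ⟨2, by rw [sq, hJJ j hj j hj]⟩
  have hC' : ∀ r ∈ zeroDivisorSet R, ∀ j ∈ J, j * f r = 0 := by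
    intro r hr j hj
    by_cases hr0 : r = 0
    · simp [hr0]
    by_cases hj0 : j = 0
    · simp [hj0]
    exact hC r hr hr0 j hj hj0
  have hmem : ∀ a ∈ zeroDivisorSet (amalgamation f J), amalgamationFst f J a ∈ zeroDivisorSet R :=
    fun a ha => mem_zeroDivisorSet_iff_not_isUnit.2 fun hu =>
      mem_zeroDivisorSet_iff_not_isUnit.1 ha (isUnit_of_isUnit_amalgamationFst hJ hu)
  intro a ha b hb
  have h1 := hA _ (hmem a ha) _ (hmem b hb)
  refine amalgamation_ext (by simpa using h1) ?_
  have hi := amalgamationSnd_sub_mem a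
  have hj := amalgamationSnd_sub_mem b
  have hf := congrArg f h1
  rw [map_mul, map_zero] at hf
  rw [map_mul, map_zero]
  linear_combination hf + hJJ _ hi _ hj + hC' _ (hmem b hb) _ hi + hC' _ (hmem a ha) _ hj

theorem exists_amalgamationInr_mem_zeroDivisorSet [Finite (amalgamation f J)] [Nontrivial R]
    (hJ0 : J ≠ ⊥) :
    ∃ (j : S) (hj : j ∈ J), j ≠ 0 ∧ amalgamationInr f hj ∈ zeroDivisorSet (amalgamation f J) := by
  have : Nontrivial (amalgamation f J) := (amalgamationFst f J).domain_nontrivial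
  obtain ⟨j, hj, hj0⟩ := Submodule.exists_mem_ne_zero_of_ne_bot hJ0
  refine ⟨j, hj, hj0, mem_zeroDivisorSet_iff_not_isUnit.2 fun hu => ?_⟩
  simpa using hu.map (amalgamationFst f J)

theorem ediam_amalgamation_eq_zero_iff [Finite (amalgamation f J)] [Finite R] [Nontrivial R]
    (hJ0 : J ≠ ⊥) :
    (zeroDivisorGraph (amalgamation f J)).ediam = 0 ↔
      IsField R ∧ ((J : Set S) \ {0}).ncard = 1 ∧ J ^ 2 = ⊥ := by
  have : Nontrivial (amalgamation f J) := (amalgamationFst f J).domain_nontrivial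
  rw [SimpleGraph.ediam_eq_zero_iff_subsingleton]
  constructor
  · intro hsub
    obtain ⟨j, hj, hj0, hjZ⟩ := exists_amalgamationInr_mem_zeroDivisorSet (f := f) hJ0
    have heq : ∀ a ∈ zeroDivisorSet (amalgamation f J), a ≠ 0 → a = amalgamationInr f hj :=
      fun a ha ha0 => congrArg Subtype.val (Subsingleton.elim
        (⟨a, ha, ha0⟩ : {a // a ∈ zeroDivisorSet (amalgamation f J) \ {0}})
        ⟨_, hjZ, mt amalgamationInr_eq_zero_iff.1 hj0⟩)
    have hmem : ∀ a : amalgamation f J, ¬ IsUnit (amalgamationFst f J a) →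
        a ∈ zeroDivisorSet (amalgamation f J) := fun a ha =>
      mem_zeroDivisorSet_iff_not_isUnit.2 fun hu => ha (hu.map _)
    have hJeq : ∀ i ∈ J, i ≠ 0 → i = j := fun i hi hi0 =>
      congrArg (amalgamationSnd f J) (heq (amalgamationInr f hi) (hmem _ (by simp))
        (mt amalgamationInr_eq_zero_iff.1 hi0))
    have hjj : j * j = 0 := by
      -- otherwise `j` is idempotent, and `1 - (0, j)` is a second vertex
      by_contra hjj
      have hidem := hJeq _ (J.mul_mem_left j hj) hjj
      have h1 : amalgamationFst f J (1 - amalgamationInr f hj) = 1 := by simp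
      have h0 : 1 - amalgamationInr f hj ≠ 0 := fun h => by simp [h] at h1
      have := heq (1 - amalgamationInr f hj) ⟨amalgamationInr f hj,
        mt amalgamationInr_eq_zero_iff.1 hj0,
        amalgamation_ext (by simp) (by simp [sub_mul, hidem])⟩ h0
      rw [this] at h1
      simp at h1
    refine ⟨⟨⟨0, 1, zero_ne_one⟩, mul_comm, fun {r} hr => ?_⟩, ?_, ?_⟩
    · by_contra hinv
      have hu : ¬ IsUnit r := fun hu => hinv hu.exists_right_inv
      have := heq (amalgamationDiag f J r) (hmem _ (by simpa using hu))
        (mt amalgamationDiag_eq_zero_iff.1 hr)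
      exact hr (congrArg (amalgamationFst f J) this)
    · rw [Set.ncard_eq_one]
      refine ⟨j, Set.eq_singleton_iff_unique_mem.2 ⟨⟨hj, hj0⟩, fun i hi => hJeq i hi.1 hi.2⟩⟩
    · rw [eq_bot_iff, sq, Ideal.mul_le]
      intro a ha b hb
      rw [Ideal.mem_bot]
      by_cases ha0 : a = 0
      · rw [ha0, zero_mul]
      by_cases hb0 : b = 0
      · rw [hb0, mul_zero]
      rw [hJeq a ha ha0, hJeq b hb hb0, hjj]
  · rintro ⟨hR, hcard, hJ2⟩
    obtain ⟨j, hj⟩ := Set.ncard_eq_one.1 hcard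
    have hJ : J ≤ nilradical S := fun i hi => mem_nilradical.2 ⟨2, by
      rw [← Ideal.mem_bot, ← hJ2]; exact Ideal.pow_mem_pow hi 2⟩
    have heq : ∀ a ∈ zeroDivisorSet (amalgamation f J), a ≠ 0 →
        amalgamationFst f J a = 0 ∧ amalgamationSnd f J a = j := by
      intro a ha ha0
      have h0 : amalgamationFst f J a = 0 := by
        by_contra hne
        obtain ⟨r, hr⟩ := hR.mul_inv_cancel hne
        exact mem_zeroDivisorSet_iff_not_isUnit.1 ha
          (isUnit_of_isUnit_amalgamationFst hJ (IsUnit.of_mul_eq_one _ hr))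
      obtain ⟨i, hi, rfl⟩ := exists_eq_amalgamationInr h0
      exact ⟨h0, (hj ▸ (⟨hi, mt amalgamationInr_eq_zero_iff.2 ha0⟩ : i ∈ (J : Set S) \ {0}) :
        i ∈ ({j} : Set S))⟩
    refine ⟨fun u v => Subtype.ext ?_⟩
    have hu := heq u u.2.1 u.2.2
    have hv := heq v v.2.1 v.2.2
    exact amalgamation_ext (hu.1.trans hv.1.symm) (hu.2.trans hv.2.symm)

theorem propABCD_of_isField [Nontrivial R] (hR : IsField R) (hJ2 : J ^ 2 = ⊥) :
    PropABCD f J := by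
  have hZ : ∀ x ∈ zeroDivisorSet R, x = 0 := by
    rintro x ⟨b, hb, hxb⟩
    by_contra hx
    obtain ⟨y, hy⟩ := hR.mul_inv_cancel hx
    exact hb (by linear_combination y * hxb - b * hy)
  refine ⟨fun x hx y _ => by rw [hZ x hx, zero_mul], fun r hr j _ hj0 hjr => ?_,
    fun r hr hr0 => absurd (hZ r hr) hr0, hJ2⟩
  have hr0 : r ≠ 0 := by
    rintro rfl
    exact hr ⟨1, one_ne_zero, zero_mul _⟩
  obtain ⟨s, hs⟩ := hR.mul_inv_cancel hr0
  exact hj0 ((IsUnit.of_mul_eq_one s hs).map f |>.mul_left_eq_zero.1 hjr)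

theorem ediam_amalgamation_le_two_iff [Finite (amalgamation f J)] [Finite R] [Nontrivial R]
    (hJ0 : J ≠ ⊥) :
    (zeroDivisorGraph (amalgamation f J)).ediam ≤ 2 ↔
      (ZeroDivisorsFormIdeal R ∧ J ≤ nilradical S) ∨
        (J ⊓ nilradical S = ⊥ ∧ (minimalPrimesAvoiding J).Subsingleton ∧ IsDomain R) := by
  have : Nontrivial (amalgamation f J) := (amalgamationFst f J).domain_nontrivial
  rw [ediam_le_two_iff, isLocalRing_amalgamation_iff, zeroDivisorsFormIdeal_iff_isLocalRing]
  refine or_congr Iff.rfl ⟨fun h => ?_, fun ⟨hnil, hsub, hR⟩ => ?_⟩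
  · obtain ⟨hR, hnil, hsub⟩ := isDomain_of_hasTwoPrimeDecomposition hJ0 h
    exact ⟨hnil, hsub, hR⟩
  · obtain ⟨q, hq⟩ := minimalPrimesAvoiding_nonempty fun hle =>
      hJ0 (by rw [← hnil, inf_eq_left.2 hle])
    exact hasTwoPrimeDecomposition_of_isDomain hJ0 hnil hq fun p hp => hsub hp hq

end Amalgamation

theorem theorem5p4 {R S : Type*} [CommRing R] [CommRing S] (f : R →+* S) (J : Ideal S)
    (hJ0 : J ≠ ⊥) (hJ1 : J ≠ ⊤) (hfin : Finite (amalgamation f J)) :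
    -- diameter 0
    (((zeroDivisorGraph (amalgamation f J)).ediam = 0 ↔
        IsField R ∧ ((J : Set S) \ {0}).ncard = 1 ∧ J ^ 2 = ⊥) ∧
      ((zeroDivisorGraph (amalgamation f J)).ediam = 0 → PropABCD f J)) ∧
    -- diameter 1
    ((zeroDivisorGraph (amalgamation f J)).ediam = 1 ↔
      Nonempty (amalgamation f J ≃+* ZMod 2 × ZMod 2) ∨
      (PropABCD f J ∧ 0 < (zeroDivisorGraph (amalgamation f J)).ediam)) ∧
    -- diameter 2
    ((zeroDivisorGraph (amalgamation f J)).ediam = 2 ↔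
      1 < (zeroDivisorGraph (amalgamation f J)).ediam ∧
      ((ZeroDivisorsFormIdeal R ∧ J ≤ nilradical S) ∨
        (J ⊓ nilradical S = ⊥ ∧ (∃! q : Ideal S, q ∈ minimalPrimesAvoiding J) ∧ IsDomain R))) ∧
    -- diameter 3
    ((zeroDivisorGraph (amalgamation f J)).ediam = 3 ↔
      (¬ ZeroDivisorsFormIdeal R ∨ ¬ J ≤ nilradical S) ∧
      (J ⊓ nilradical S ≠ ⊥ ∨ (minimalPrimesAvoiding J).Nontrivial ∨ ¬ IsDomain R)) := by
  have : Nontrivial S := Submodule.nontrivial_iff S |>.1 ⟨J, ⊤, hJ1⟩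
  have : Nontrivial R := f.domain_nontrivial
  have : Finite R := Finite.of_surjective _ (amalgamationFst_surjective (f := f) (J := J))
  have h0 := ediam_amalgamation_eq_zero_iff (f := f) hJ0
  have h2 := ediam_amalgamation_le_two_iff (f := f) hJ0
  refine ⟨⟨h0, fun h => propABCD_of_isField (h0.1 h).1 (h0.1 h).2.2⟩, ⟨fun h => ?_, ?_⟩, ?_, ?_⟩
  · refine (nonempty_ringEquiv_or_propA_of_ediam_eq_one h).imp_right fun hA =>
      ⟨propABCD_of_propA_amalgamation hA, ?_⟩
    rw [h]
    exact one_pos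
  · rintro (h | ⟨h, hpos⟩)
    · exact ediam_eq_one_of_ringEquiv h
    · exact ediam_eq_one_of_propA (propA_amalgamation_of_propABCD h) hpos
  · have huniq : J ⊓ nilradical S = ⊥ → ((∃! q : Ideal S, q ∈ minimalPrimesAvoiding J) ↔
        (minimalPrimesAvoiding J).Subsingleton) := by
      intro hnil
      refine ⟨fun ⟨q, _, hq⟩ p hp p' hp' => (hq p hp).trans (hq p' hp').symm, fun hsub => ?_⟩
      obtain ⟨q, hq⟩ := minimalPrimesAvoiding_nonempty fun hle =>
        hJ0 (by rw [← hnil, inf_eq_left.2 hle])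
      exact ⟨q, hq, fun p hp => hsub hp hq⟩
    rw [and_congr_right fun hnil => and_congr_left fun _ => huniq hnil, ← h2]
    constructor
    · intro h
      rw [h]
      exact ⟨by norm_num, le_rfl⟩
    · rintro ⟨h1, h⟩
      refine le_antisymm h ?_
      rw [← one_add_one_eq_two]
      exact Order.add_one_le_of_lt h1
  · have h3 : (zeroDivisorGraph (amalgamation f J)).ediam = 3 ↔
        ¬ (zeroDivisorGraph (amalgamation f J)).ediam ≤ 2 := by
      rw [not_le]
      constructor
      · intro h
        rw [h]
        norm_num
      · intro h
        refine le_antisymm ediam_zeroDivisorGraph_le_three ?_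
        rw [show (3 : ℕ∞) = 2 + 1 by norm_num]
        exact Order.add_one_le_of_lt h
    rw [h3, h2, ← Set.not_subsingleton_iff]
    rw [not_or, not_and_or, not_and_or, not_and_or]
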